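/- All functions and functionals are real-valued. Let $(G,c)$ be a connected resistance network with vertex set $V$ and base point $o\in V$: $c_{xy}=c_{yx}\ge 0$, $c_{xx}=0$, $c(x)=\sum_y c_{xy}<\infty$ for every $x$, and any two vertices are joined by a finite path of edges with $c_{xy}>0$. The energy form is $\mathcal E(u,v)=\frac12\sum_{x,y}c_{xy}(u(x)-u(y))(v(x)-v(y))$, and $H_{\mathcal E}$ is the Hilbert space of functions of finite energy modulo constants, with $\langle u,v\rangle_{\mathcal E}=\mathcal E(u,v)$. The energy kernel $v_x\in H_{\mathcal E}$ is defined by $\langle v_x,u\rangle_{\mathcal E}=u(x)-u(o)$ for all $u\in H_{\mathcal E}$. Let $T$ be one of the following operators in $H_{\mathcal E}$. (a) The closed number operator, when $V$ is infinite: for an enumeration $x_1,x_2,\dots$ of $V\setminus\{o\}$, let $(\varepsilon_n)_{n\ge1}$ be obtained from $(v_{x_n})_{n\ge 1}$ by the Gram--Schmidt process, and let $T$ be the closure of the operator $N$ with domain $\operatorname{span}\{v_x\}$ given by $Nv_{x_n}=\sum_{k=1}^n k\,(\varepsilon_k(x_n)-\varepsilon_k(o))\,\varepsilon_k$ (so that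 $N\varepsilon_k=k\varepsilon_k$). (b) Any self-adjoint extension of the closed Laplacian $\Delta_M$, when $\Delta_M$ is unbounded. Here $\Delta_M$ is the closure of the operator $(\Delta u)(x)=\sum_y c_{xy}(u(x)-u(y))$ with domain $\operatorname{span}\{v_x\}_{x\in V}+\operatorname{span}\{v_x+w_o,\,f_x+w_o\}_{x\in V}$, where $f_x$ is the orthogonal projection of $v_x$ to the closed span of the finitely supported functions and $w_o$ is the energy-minimizing $w\in H_{\mathcal E}$ with $\Delta w=\delta_o$ (the second span is omitted if no such $w$ exists). Let $S=\operatorname{dom}(T^\infty)=\bigcap_p\operatorname{dom}(T^p)$ with the topology of the seminorms $\|u\|_p=\|T^pu\|_{\mathcal E}$, $p=0,1,2,\dots$, and let $S'$ be the (strong) dual of $S$. Then: 1. $S\subset H_{\mathcal E}\subset S'$ is a Gel'fand triple: $S$ is a dense proper subspace of $H_{\mathcal E}$, a Fréchet space whose topology is strictly finer than that of $H_{\mathcal E}$, and $h\mapsto\langle h,\cdot\rangle_{\mathcal E}|_S$ is a continuous injection of $H_{\mathcal E}$ onto a proper subspace of $S'$. In case (a) the inclusion $S\hookrightarrow H_{\mathcal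 E}$ is moreover nuclear. 2. The energy form extends to the bilinear pairing $\langle u,v\rangle_W=v(u)$ on $S\times S'$, that is, $\langle u,h\rangle_W=\langle u,h\rangle_{\mathcal E}$ for $u\in S$, $h\in H_{\mathcal E}$. If $v\in S'$ and $p\ge0$ is any integer such that for some $K>0$ one has $|v(u)|\le K\|T^pu\|_{\mathcal E}$ for all $u\in S$, then there is a unique $w=:T^{-p}v$ in the closure of $T^pS$ in $H_{\mathcal E}$ with $v(u)=\langle T^pu,w\rangle_{\mathcal E}$ for all $u\in S$, so that $$\langle u,v\rangle_W=\langle T^pu,T^{-p}v\rangle_{\mathcal E}\qquad(u\in S).$$ 3. Such a $p$ exists for every $v\in S'$ in case (a), and in case (b) if $T$ is bounded below ($\|Tu\|_{\mathcal E}\ge\delta\|u\|_{\mathcal E}$ on $\operatorname{dom}T$ for some $\delta>0$). In all cases, for every $v\in S'$ there are $p\ge 0$ and $w_0,\dots,w_p\in H_{\mathcal E}$ with $\langle u,v\rangle_W=\sum_{k=0}^p\langle T^ku,w_k\rangle_{\mathcal E}$ for all $u\in S$. -/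

import Mathlib

open scoped InnerProductSpace

noncomputable section

/-! ## Resistance networks and the energy space (all functions are real-valued) -/

/-- A resistance network with vertex set `V`: symmetric nonnegative conductances without loops, with
`c(x) = ∑ y, c x y` finite for every vertex, and connected through the edges `c x y > 0`. -/
structure ResistanceNetwork (V : Type*) where
  c : V → V → ℝ
  symm : ∀ x y, c x y = c y x
  nonneg : ∀ x y, 0 ≤ c x y
  no_loop : ∀ x, c x x = 0
  summable : ∀ x, Summable (c x)
  connected : ∀ x y, Relation.ReflTransGen (fun a b => 0 < c a b) x y

namespace ResistanceNetwork

variable {V : Type*} (G : ResistanceNetwork V)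

/-- The Laplacian `(Δ u)(x) = ∑ y, c x y * (u x - u y)`. -/
def laplacian (u : V → ℝ) (x : V) : ℝ := ∑' y, G.c x y * (u x - u y)

/-- The energy form `E(u,v) = 1/2 ∑ x, ∑ y, c x y * (u x - u y) * (v x - v y)`. -/
def energy (u v : V → ℝ) : ℝ :=
  (1 / 2) * ∑' p : V × V, G.c p.1 p.2 * (u p.1 - u p.2) * (v p.1 - v p.2)

/-- The domain of the energy: the functions of finite energy. -/
def domE : Submodule ℝ (V → ℝ) where
  carrier := {u | Summable fun p : V × V => G.c p.1 p.2 * (u p.1 - u p.2) ^ 2}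
  zero_mem' := by simp [summable_zero]
  add_mem' := by
    intro u v hu hv
    refine Summable.of_nonneg_of_le (fun p => mul_nonneg (G.nonneg _ _) (sq_nonneg _)) (fun p => ?_)
      ((hu.add hv).mul_left 2)
    have h := G.nonneg p.1 p.2
    have := mul_nonneg h (sq_nonneg ((u p.1 - u p.2) - (v p.1 - v p.2)))
    simp only [Pi.add_apply]
    nlinarith
  smul_mem' := by
    intro a u hu
    refine (hu.mul_left (a ^ 2)).congr (fun p => ?_)
    simp only [Pi.smul_apply, smul_eq_mul]
    ring

lemma summable_energy (u v : G.domE) :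
    Summable fun p : V × V =>
      G.c p.1 p.2 * (u.1 p.1 - u.1 p.2) * (v.1 p.1 - v.1 p.2) := by
  refine Summable.of_norm_bounded (u.2.add v.2) (fun p => ?_)
  have h := G.nonneg p.1 p.2
  rw [Real.norm_eq_abs, mul_assoc, abs_mul, abs_of_nonneg h, ← mul_add]
  refine mul_le_mul_of_nonneg_left ?_ h
  rw [abs_le]
  constructor <;>
    nlinarith [sq_nonneg ((u.1 p.1 - u.1 p.2) + (v.1 p.1 - v.1 p.2)),
      sq_nonneg ((u.1 p.1 - u.1 p.2) - (v.1 p.1 - v.1 p.2)),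
      sq_nonneg (u.1 p.1 - u.1 p.2), sq_nonneg (v.1 p.1 - v.1 p.2)]

/-- The constant functions, as a subspace of the domain of the energy. -/
def constants : Submodule ℝ G.domE where
  carrier := {u | ∃ k : ℝ, ∀ x, u.1 x = k}
  zero_mem' := ⟨0, fun _ => rfl⟩
  add_mem' := by
    rintro u v ⟨k, hk⟩ ⟨l, hl⟩
    exact ⟨k + l, fun x => by simp [hk, hl]⟩
  smul_mem' := by
    rintro a u ⟨k, hk⟩
    exact ⟨a * k, fun x => by simp [hk]⟩

/-- The energy space: functions of finite energy modulo constants. -/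
def EnergySpace : Type _ := G.domE ⧸ G.constants

instance : AddCommGroup G.EnergySpace := inferInstanceAs (AddCommGroup (G.domE ⧸ G.constants))

instance : Module ℝ G.EnergySpace := inferInstanceAs (Module ℝ (G.domE ⧸ G.constants))

/-- The class of a function of finite energy. -/
def cls : G.domE →ₗ[ℝ] G.EnergySpace := G.constants.mkQ

lemma cls_surjective : Function.Surjective G.cls := G.constants.mkQ_surjective

lemma cls_eq_zero {u : G.domE} : G.cls u = 0 ↔ ∃ k : ℝ, ∀ x, u.1 x = k :=
  Submodule.Quotient.mk_eq_zero G.constants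

lemma diff_eq_of_cls_eq {u v : G.domE} (h : G.cls u = G.cls v) (x y : V) :
    u.1 x - u.1 y = v.1 x - v.1 y := by
  have h1 : G.cls (u - v) = 0 := by rw [map_sub, h, sub_self]
  obtain ⟨k, hk⟩ := G.cls_eq_zero.1 h1
  have h2 := hk x
  have h3 := hk y
  simp only [Submodule.coe_sub, Pi.sub_apply] at h2 h3
  linarith

lemma energy_congr {u u' v v' : G.domE} (hu : G.cls u = G.cls u') (hv : G.cls v = G.cls v') :
    G.energy u.1 v.1 = G.energy u'.1 v'.1 := by
  unfold energy
  congr 1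
  refine tsum_congr fun p => ?_
  rw [G.diff_eq_of_cls_eq hu, G.diff_eq_of_cls_eq hv]

instance : Inner ℝ G.EnergySpace where
  inner a b := Quotient.liftOn₂' (s₁ := G.constants.quotientRel) (s₂ := G.constants.quotientRel)
    a b (fun u v => G.energy u.1 v.1) (fun _ _ _ _ h1 h2 =>
      G.energy_congr (Quotient.sound' h1) (Quotient.sound' h2))

lemma inner_cls (u v : G.domE) : ⟪G.cls u, G.cls v⟫_ℝ = G.energy u.1 v.1 := rfl

lemma energy_self_nonneg (u : V → ℝ) : 0 ≤ G.energy u u := by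
  refine mul_nonneg (by norm_num) (tsum_nonneg fun p => ?_)
  rw [mul_assoc]
  exact mul_nonneg (G.nonneg _ _) (mul_self_nonneg _)

lemma edge_le_energy (u : G.domE) (x y : V) :
    G.c x y * (u.1 x - u.1 y) ^ 2 ≤ 2 * G.energy u.1 u.1 := by
  have h := (G.summable_energy u u).le_tsum (x, y) (fun p _ => by
    rw [mul_assoc]; exact mul_nonneg (G.nonneg _ _) (mul_self_nonneg _))
  unfold energy
  dsimp only at h
  nlinarith

lemma eq_of_energy_eq_zero (u : G.domE) (h : G.energy u.1 u.1 = 0) (x y : V) :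
    u.1 x = u.1 y := by
  induction G.connected x y with
  | refl => rfl
  | tail _ hbc ih =>
    rename_i b d _
    rw [ih]
    have h1 := G.edge_le_energy u b d
    rw [h, mul_zero] at h1
    have h2 : (u.1 b - u.1 d) ^ 2 ≤ 0 := by
      by_contra hn
      exact absurd (mul_pos hbc (not_le.1 hn)) (not_lt.2 h1)
    have h3 : u.1 b - u.1 d = 0 := by
      have := le_antisymm h2 (sq_nonneg _)
      exact pow_eq_zero_iff (two_ne_zero) |>.1 this
    linarith

/-- The energy inner product. -/
abbrev energyCore : InnerProductSpace.Core ℝ G.EnergySpace where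
  inner a b := ⟪a, b⟫_ℝ
  conj_inner_symm a b := by
    obtain ⟨u, rfl⟩ := G.cls_surjective a
    obtain ⟨v, rfl⟩ := G.cls_surjective b
    simp only [inner_cls, energy, conj_trivial]
    congr 1
    exact tsum_congr fun p => by ring
  re_inner_nonneg a := by
    obtain ⟨u, rfl⟩ := G.cls_surjective a
    exact G.energy_self_nonneg _
  add_left a b d := by
    obtain ⟨u, rfl⟩ := G.cls_surjective a
    obtain ⟨v, rfl⟩ := G.cls_surjective b
    obtain ⟨w, rfl⟩ := G.cls_surjective d
    rw [← map_add]
    simp only [inner_cls, energy]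
    rw [← mul_add, ← (G.summable_energy u w).tsum_add (G.summable_energy v w)]
    congr 1
    exact tsum_congr fun p => by simp only [Submodule.coe_add, Pi.add_apply]; ring
  smul_left a b r := by
    obtain ⟨u, rfl⟩ := G.cls_surjective a
    obtain ⟨v, rfl⟩ := G.cls_surjective b
    rw [← map_smul]
    simp only [inner_cls, energy, conj_trivial]
    rw [mul_left_comm, ← tsum_mul_left (a := r)]
    congr 1
    exact tsum_congr fun p => by
      simp only [Submodule.coe_smul, Pi.smul_apply, smul_eq_mul]; ring
  definite a h := by
    obtain ⟨u, rfl⟩ := G.cls_surjective a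
    rw [cls_eq_zero]
    rcases isEmpty_or_nonempty V with hV | ⟨⟨x⟩⟩
    · exact ⟨0, fun x => (hV.false x).elim⟩
    · exact ⟨u.1 x, fun y => G.eq_of_energy_eq_zero u h y x⟩

instance : NormedAddCommGroup G.EnergySpace :=
  @InnerProductSpace.Core.toNormedAddCommGroup ℝ G.EnergySpace _ _ _ G.energyCore

instance : InnerProductSpace ℝ G.EnergySpace := InnerProductSpace.ofCore G.energyCore.toCore

/-- The inner product of the Hilbert space is the energy form. -/
lemma inner_eq_energy (u v : G.domE) : ⟪G.cls u, G.cls v⟫_ℝ = G.energy u.1 v.1 := rfl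

lemma norm_cls_sq (u : G.domE) : ‖G.cls u‖ ^ 2 = G.energy u.1 u.1 := by
  rw [← real_inner_self_eq_norm_sq]; rfl

/-- The functional `u ↦ u(x) - u(y)` on the energy space. -/
def evalDiff (x y : V) : G.EnergySpace →ₗ[ℝ] ℝ :=
  G.constants.liftQ
    { toFun := fun u => u.1 x - u.1 y
      map_add' := fun u v => by simp only [Submodule.coe_add, Pi.add_apply]; ring
      map_smul' := fun r u => by
        simp only [Submodule.coe_smul, Pi.smul_apply, smul_eq_mul, RingHom.id_apply]; ring } (by
      rintro u ⟨k, hk⟩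
      rw [LinearMap.mem_ker]
      change u.1 x - u.1 y = 0
      rw [hk, hk, sub_self])

lemma evalDiff_cls (x y : V) (u : G.domE) : G.evalDiff x y (G.cls u) = u.1 x - u.1 y := rfl

lemma exists_bound_evalDiff (x y : V) : ∃ C, ∀ a, ‖G.evalDiff x y a‖ ≤ C * ‖a‖ := by
  induction G.connected x y with
  | refl =>
    refine ⟨0, fun a => ?_⟩
    obtain ⟨u, rfl⟩ := G.cls_surjective a
    simp [evalDiff_cls]
  | tail _ hbc ih =>
    rename_i b d _
    obtain ⟨C, hC⟩ := ih
    refine ⟨C + Real.sqrt (2 / G.c b d), fun a => ?_⟩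
    have h1 := hC a
    obtain ⟨u, rfl⟩ := G.cls_surjective a
    rw [evalDiff_cls, Real.norm_eq_abs] at h1 ⊢
    have h2 : |u.1 b - u.1 d| ≤ Real.sqrt (2 / G.c b d) * ‖G.cls u‖ := by
      refine abs_le_of_sq_le_sq ?_ (by positivity)
      rw [mul_pow, Real.sq_sqrt (by positivity), norm_cls_sq, div_mul_eq_mul_div, le_div_iff₀ hbc]
      have := G.edge_le_energy u b d
      linarith
    have h3 : u.1 x - u.1 d = (u.1 x - u.1 b) + (u.1 b - u.1 d) := by ring
    rw [h3, add_mul]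
    exact (abs_add_le _ _).trans (add_le_add h1 h2)

instance : CompleteSpace G.EnergySpace := by
  rcases isEmpty_or_nonempty V with hV | ⟨⟨o⟩⟩
  · have : Subsingleton G.EnergySpace := by
      refine ⟨fun a b => ?_⟩
      obtain ⟨u, rfl⟩ := G.cls_surjective a
      obtain ⟨v, rfl⟩ := G.cls_surjective b
      congr 1
      exact Subtype.ext (funext fun x => (hV.false x).elim)
    infer_instance
  refine Metric.complete_of_cauchySeq_tendsto fun a ha => ?_
  choose u hu using fun n => G.cls_surjective (a n)
  have hlim : ∀ x, ∃ l, Filter.Tendsto (fun n => (u n).1 x - (u n).1 o) Filter.atTop (nhds l) := by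
    intro x
    have hc : CauchySeq fun n => G.evalDiff x o (a n) :=
      ((G.evalDiff x o).mkContinuousOfExistsBound
        (G.exists_bound_evalDiff x o)).uniformContinuous.comp_cauchySeq ha
    obtain ⟨l, hl⟩ := cauchySeq_tendsto_of_complete hc
    refine ⟨l, hl.congr fun n => ?_⟩
    rw [← hu n, evalDiff_cls]
  choose w hw using hlim
  have hdiff : ∀ x y, Filter.Tendsto (fun n => (u n).1 x - (u n).1 y) Filter.atTop
      (nhds (w x - w y)) := fun x y => ((hw x).sub (hw y)).congr fun n => by ring
  have key : ∀ ε > 0, ∃ N, ∀ n ≥ N, ∀ s : Finset (V × V),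
      ∑ p ∈ s, G.c p.1 p.2 * ((w - (u n).1) p.1 - (w - (u n).1) p.2) ^ 2 ≤ 2 * ε ^ 2 := by
    intro ε hε
    obtain ⟨N, hN⟩ := Metric.cauchySeq_iff.1 ha ε hε
    refine ⟨N, fun n hn s => ?_⟩
    have ht : Filter.Tendsto (fun m => ∑ p ∈ s,
        G.c p.1 p.2 * ((u m - u n).1 p.1 - (u m - u n).1 p.2) ^ 2) Filter.atTop
        (nhds (∑ p ∈ s, G.c p.1 p.2 * ((w - (u n).1) p.1 - (w - (u n).1) p.2) ^ 2)) := by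
      refine tendsto_finsetSum _ fun p _ => Filter.Tendsto.const_mul _ (Filter.Tendsto.pow ?_ 2)
      have := (hdiff p.1 p.2).sub_const ((u n).1 p.1 - (u n).1 p.2)
      convert this using 2
      · simp only [Submodule.coe_sub, Pi.sub_apply]; ring
      · simp only [Pi.sub_apply]; ring
    refine le_of_tendsto ht (Filter.eventually_atTop.2 ⟨N, fun m hm => ?_⟩)
    have h1 : ‖G.cls (u m - u n)‖ < ε := by
      rw [map_sub, hu, hu, ← dist_eq_norm]; exact hN m hm n hn
    have h2 : ‖G.cls (u m - u n)‖ ^ 2 ≤ ε ^ 2 := pow_le_pow_left₀ (norm_nonneg _) h1.le 2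
    rw [norm_cls_sq] at h2
    have h3 := (u m - u n).2.sum_le_tsum s
      (fun p _ => mul_nonneg (G.nonneg _ _) (sq_nonneg _))
    refine h3.trans ?_
    have h4 : ∑' p : V × V, G.c p.1 p.2 * ((u m - u n).1 p.1 - (u m - u n).1 p.2) ^ 2
        = 2 * G.energy (u m - u n).1 (u m - u n).1 := by
      unfold energy
      rw [← mul_assoc, mul_one_div_cancel two_ne_zero, one_mul]
      exact tsum_congr fun p => by ring
    rw [h4]
    linarith
  have hmem : ∀ n (C : ℝ), (∀ s : Finset (V × V),
      ∑ p ∈ s, G.c p.1 p.2 * ((w - (u n).1) p.1 - (w - (u n).1) p.2) ^ 2 ≤ C) →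
      w - (u n).1 ∈ G.domE := fun n C hC =>
    summable_of_sum_le (fun p => mul_nonneg (G.nonneg _ _) (sq_nonneg _)) hC
  obtain ⟨N₀, hN₀⟩ := key 1 one_pos
  have hwm : w ∈ G.domE := by
    have := G.domE.add_mem (hmem N₀ _ (hN₀ N₀ le_rfl)) (u N₀).2
    simpa using this
  refine ⟨G.cls ⟨w, hwm⟩, ?_⟩
  rw [Metric.tendsto_atTop]
  intro ε hε
  obtain ⟨N, hN⟩ := key (ε / 2) (by positivity)
  refine ⟨N, fun n hn => ?_⟩
  have h1 : ‖G.cls (⟨w, hwm⟩ - u n)‖ ^ 2 ≤ (ε / 2) ^ 2 := by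
    rw [norm_cls_sq]
    have h4 : G.energy (⟨w, hwm⟩ - u n : G.domE).1 (⟨w, hwm⟩ - u n : G.domE).1
        = (1 / 2) * ∑' p : V × V,
          G.c p.1 p.2 * ((w - (u n).1) p.1 - (w - (u n).1) p.2) ^ 2 := by
      unfold energy
      congr 1
      exact tsum_congr fun p => by simp only [Submodule.coe_sub]; ring
    rw [h4]
    have h5 := Real.tsum_le_of_sum_le
      (fun p : V × V => mul_nonneg (G.nonneg p.1 p.2) (sq_nonneg _)) (hN n hn)
    linarith
  have h2 := abs_le_of_sq_le_sq' h1 (by positivity)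
  rw [dist_comm, dist_eq_norm, ← hu n, ← map_sub]
  linarith [h2.2]

/-- The energy kernel `v_x`: the element with `⟪v_x, u⟫ = u(x) - u(o)` for all `u`. -/
def kernel (o x : V) : G.EnergySpace :=
  (InnerProductSpace.toDual ℝ G.EnergySpace).symm
    ((G.evalDiff x o).mkContinuousOfExistsBound (G.exists_bound_evalDiff x o))

lemma inner_kernel (o x : V) (a : G.EnergySpace) :
    ⟪G.kernel o x, a⟫_ℝ = G.evalDiff x o a := by
  rw [kernel, InnerProductSpace.toDual_symm_apply]
  rfl

/-! ## The number operator -/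

/-- The orthonormal system `ε_0, ε_1, …` obtained by the Gram-Schmidt process from `v_{x_0}, v_{x_1},
…`, where `x_n = e n` is an enumeration of the vertices other than `o`. -/
def onb (o : V) (e : ℕ ≃ {x : V // x ≠ o}) : ℕ → G.EnergySpace :=
  InnerProductSpace.gramSchmidtNormed ℝ fun n => G.kernel o (e n)

/-- The number operator on `span {v_x}`: since the enumeration starts at `0`,
`N v_{x_n} = ∑ k ≤ n, (k + 1) * (ε_k(x_n) - ε_k(o)) • ε_k`, and so `N ε_k = (k + 1) • ε_k`. -/
def numberOperator (o : V) (e : ℕ ≃ {x : V // x ≠ o}) : G.EnergySpace →ₗ.[ℝ] G.EnergySpace :=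
  (Submodule.span ℝ (Set.range fun n : ℕ =>
    (G.kernel o (e n), ∑ k ∈ Finset.range (n + 1),
      (((k : ℝ) + 1) * G.evalDiff (e n) o (G.onb o e k)) • G.onb o e k))).toLinearPMap

/-! ## The Laplacian as an operator on the energy space -/

/-- `Fin`: the closed span of the (classes of) functions which are constant off a finite set. -/
def finSpace : Submodule ℝ G.EnergySpace :=
  (Submodule.span ℝ {a | ∃ u : G.domE, G.cls u = a ∧
    ∃ k : ℝ, {x | u.1 x ≠ k}.Finite}).topologicalClosure

instance : G.finSpace.HasOrthogonalProjection :=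
  inferInstanceAs (Submodule.HasOrthogonalProjection (Submodule.topologicalClosure _))

/-- `w` is a monopole at `x`: `Δ w` is the Kronecker delta at `x`. -/
def IsMonopole (x : V) (w : G.EnergySpace) : Prop :=
  ∃ u : G.domE, G.cls u = w ∧ G.laplacian u.1 x = 1 ∧ ∀ y, y ≠ x → G.laplacian u.1 y = 0

/-- `w` is an energy-minimizing monopole at `x`. -/
def IsMinMonopole (x : V) (w : G.EnergySpace) : Prop :=
  G.IsMonopole x w ∧ ∀ w', G.IsMonopole x w' → ‖w‖ ≤ ‖w'‖

/-- The space spanned by the `v_x` and by the monopoles `v_x + w_o` and `f_x + w_o`, where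
`f_x` is the projection of `v_x` to `Fin`; it is the span of the `v_x` if there are no monopoles. -/
def monopoleSpan (o : V) : Submodule ℝ G.EnergySpace :=
  Submodule.span ℝ (Set.range (G.kernel o)) ⊔
    Submodule.span ℝ {a | ∃ x w, G.IsMinMonopole o w ∧
      (a = G.kernel o x + w ∨ a = G.finSpace.starProjection (G.kernel o x) + w)}

/-- The pointwise Laplacian with domain `monopoleSpan`: it takes the class of `u` to that of `Δ u`. -/
def laplacianOn (o : V) : G.EnergySpace →ₗ.[ℝ] G.EnergySpace :=
  (Submodule.span ℝ {p : G.EnergySpace × G.EnergySpace | p.1 ∈ G.monopoleSpan o ∧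
    ∃ u f : G.domE, G.cls u = p.1 ∧ G.cls f = p.2 ∧ ∀ x, f.1 x = G.laplacian u.1 x}).toLinearPMap

/-- The closure `Δ_M` of the Laplacian. -/
def laplacianM (o : V) : G.EnergySpace →ₗ.[ℝ] G.EnergySpace := (G.laplacianOn o).closure

end ResistanceNetwork

/-! ## Powers of an operator and the test space `dom(T^∞)` -/

section Operator

variable {H : Type*} [NormedAddCommGroup H] [InnerProductSpace ℝ H]

/-- A partially defined operator is unbounded. -/
def IsUnboundedOp (T : H →ₗ.[ℝ] H) : Prop := ¬ ∃ C : ℝ, ∀ u : T.domain, ‖T u‖ ≤ C * ‖(u : H)‖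

/-- The power `T^p`, where `dom(T^(p+1))` consists of the `u` in `dom(T^p)` for which `T^p u`
belongs to `dom(T)`. -/
def opPow (T : H →ₗ.[ℝ] H) : ℕ → (H →ₗ.[ℝ] H)
  | 0 => ⟨⊤, (⊤ : Submodule ℝ H).subtype⟩
  | p + 1 => T.comp ((opPow T p).domRestrict
      ((T.domain.comap (opPow T p).toFun).map (opPow T p).domain.subtype)) (by
        rintro ⟨x, hx⟩
        obtain ⟨⟨y, hy, rfl⟩, h2⟩ := hx
        exact hy)

lemma mem_opPow_succ (T : H →ₗ.[ℝ] H) (p : ℕ) (u : H) :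
    u ∈ (opPow T (p + 1)).domain ↔
      ∃ h : u ∈ (opPow T p).domain, opPow T p ⟨u, h⟩ ∈ T.domain := by
  constructor
  · rintro ⟨⟨y, hy, rfl⟩, h2⟩
    exact ⟨y.2, hy⟩
  · rintro ⟨h, h'⟩
    exact ⟨⟨⟨u, h⟩, h', rfl⟩, h⟩

lemma opPow_succ_apply (T : H →ₗ.[ℝ] H) (p : ℕ) (u : H) (hu : u ∈ (opPow T (p + 1)).domain)
    (h : u ∈ (opPow T p).domain) (h' : opPow T p ⟨u, h⟩ ∈ T.domain) :
    opPow T (p + 1) ⟨u, hu⟩ = T ⟨opPow T p ⟨u, h⟩, h'⟩ := rfl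

/-- The test space `S = dom(T^∞)`. -/
def TestSpace (T : H →ₗ.[ℝ] H) : Type _ := ↥(⨅ p, (opPow T p).domain)

variable (T : H →ₗ.[ℝ] H)

instance : AddCommGroup (TestSpace T) :=
  inferInstanceAs (AddCommGroup ↥(⨅ p, (opPow T p).domain))

instance : Module ℝ (TestSpace T) :=
  inferInstanceAs (Module ℝ ↥(⨅ p, (opPow T p).domain))

/-- The restriction of `T^p` to the test space. -/
def powOn (p : ℕ) : TestSpace T →ₗ[ℝ] H :=
  (opPow T p).toFun ∘ₗ Submodule.inclusion (iInf_le (fun q => (opPow T q).domain) p)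

/-- The seminorms `‖u‖_p = ‖T^p u‖`, `p = 0, 1, 2, …`. -/
def testSeminorm : SeminormFamily ℝ (TestSpace T) ℕ :=
  fun p => (normSeminorm ℝ H).comp (powOn T p)

/-- The topology on the test space defined by the seminorms `‖T^p u‖`. -/
instance : TopologicalSpace (TestSpace T) := (testSeminorm T).moduleFilterBasis.topology

lemma withSeminorms_testSeminorm : WithSeminorms (testSeminorm T) := ⟨rfl⟩

instance : IsTopologicalAddGroup (TestSpace T) :=
  (withSeminorms_testSeminorm T).topologicalAddGroup

instance : ContinuousSMul ℝ (TestSpace T) := (withSeminorms_testSeminorm T).continuousSMul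

/-- The inclusion of the test space in the Hilbert space. -/
def testIncl : TestSpace T →L[ℝ] H where
  toLinearMap := Submodule.subtype (⨅ p, (opPow T p).domain)
  cont := by
    refine WithSeminorms.continuous_normedSpace_rng H (withSeminorms_testSeminorm T) _
      ⟨{0}, 1, ?_⟩
    intro u
    simp only [Finset.sup_singleton, one_smul]
    exact le_rfl

end Operator

/-! ## Gel'fand triples -/

section Gelfand

variable {S H : Type*} [AddCommGroup S] [Module ℝ S] [TopologicalSpace S]
  [IsTopologicalAddGroup S] [ContinuousSMul ℝ S] [NormedAddCommGroup H] [InnerProductSpace ℝ H]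

/-- The map `H → S'`, `h ↦ ⟪h, ·⟫` restricted to `S`, where `S'` is the dual of `S` with the strong
topology. -/
def dualIncl (ι : S →L[ℝ] H) : H →L[ℝ] (S →L[ℝ] ℝ) :=
  (ContinuousLinearMap.precomp ℝ ι).comp (innerSL ℝ)

/-- `S ⊂ H ⊂ S'` is a Gel'fand triple (rigged Hilbert space): `S` is a dense proper subspace of `H`
with a Fréchet topology that is strictly finer than the one of `H`, and `H` is included continuously
as a proper subspace in the dual `S'`. (The continuity of both inclusions is part of their types.) -/
structure IsGelfandTriple (ι : S →L[ℝ] H) : Prop where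
  locallyConvex : LocallyConvexSpace ℝ S
  metrizable : TopologicalSpace.MetrizableSpace S
  complete : @CompleteSpace S (IsTopologicalAddGroup.rightUniformSpace S)
  injective : Function.Injective ι
  dense : DenseRange ι
  strictlyFiner : (inferInstance : TopologicalSpace S) < TopologicalSpace.induced ι inferInstance
  proper : ¬ Function.Surjective ι
  dual_injective : Function.Injective (dualIncl ι)
  dual_proper : ¬ Function.Surjective (dualIncl ι)

/-- A nuclear map into a Hilbert space: `f u = ∑ n, a n * φ n u • y n` with `a` absolutely summable,
`φ` an equicontinuous sequence of functionals and `y` a bounded sequence. -/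
def IsNuclearMap (f : S →L[ℝ] H) : Prop :=
  ∃ (a : ℕ → ℝ) (φ : ℕ → S →L[ℝ] ℝ) (y : ℕ → H),
    Summable (fun n => |a n|) ∧
    (∃ U ∈ nhds (0 : S), ∀ n, ∀ u ∈ U, |φ n u| ≤ 1) ∧
    (∃ C, ∀ n, ‖y n‖ ≤ C) ∧
    ∀ u, HasSum (fun n => (a n * φ n u) • y n) (f u)

end Gelfand

section Pairing

variable {H : Type*} [NormedAddCommGroup H] [InnerProductSpace ℝ H] (T : H →ₗ.[ℝ] H)

/-- `p` is such that `|v(u)| ≤ K ‖T^p u‖` on `S`, for some `K > 0`. -/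
def IsOrderBound (v : TestSpace T →L[ℝ] ℝ) (p : ℕ) : Prop :=
  ∃ K > 0, ∀ u, |v u| ≤ K * ‖powOn T p u‖

/-- `w = T^(-p) v`: the vector `w` in the closure of `T^p S` that represents the functional
`T^p u ↦ v(u)`. -/
def IsNegPow (p : ℕ) (v : TestSpace T →L[ℝ] ℝ) (w : H) : Prop :=
  w ∈ closure (Set.range (powOn T p)) ∧ ∀ u, v u = ⟪powOn T p u, w⟫_ℝ

/-- The inner product of `H` extends to a pairing `⟨u, v⟩_W` of `S` and `S'` (the duality, bilinear,
with `⟨u, h⟩_W = ⟪u, h⟫` for `h` in `H`), and `⟨u, v⟩_W = ⟪T^p u, T^(-p) v⟫` for every `p` such that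
`|v(u)| ≤ K ‖T^p u‖` on `S`, where `T^(-p) v` exists and is unique for each such `p`. Every `v` in
`S'` moreover is a finite sum of functionals `⟪T^k ·, w_k⟫`. -/
def HasEnergyPairing : Prop :=
  ∃ B : TestSpace T →ₗ[ℝ] (TestSpace T →L[ℝ] ℝ) →ₗ[ℝ] ℝ,
    (∀ u v, B u v = v u) ∧
    (∀ u h, B u (dualIncl (testIncl T) h) = ⟪testIncl T u, h⟫_ℝ) ∧
    (∀ v p, IsOrderBound T v p →
      ∃! w, IsNegPow T p v w ∧ ∀ u, B u v = ⟪powOn T p u, w⟫_ℝ) ∧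
    (∀ v, ∃ (p : ℕ) (w : ℕ → H), ∀ u, B u v = ∑ k ∈ Finset.range (p + 1), ⟪powOn T k u, w k⟫_ℝ)

end Pairing

end

/-! ## The test space of an operator -/

section TestSpaceTheory

open Filter Topology

variable {H : Type*} [NormedAddCommGroup H] [InnerProductSpace ℝ H] {T : H →ₗ.[ℝ] H}

/-! Three properties of `T` carry everything: it is closed, it is unbounded, and `dom(T^∞)` is
dense.

Closedness gives completeness: if all the sequences `T^p u_n` converge, their limits form a chain in
the graph of `T`, hence are the iterates of one point of `S`. Unboundedness makes everything strict
(`isGelfandTriple_testIncl`). If the topology of `S` were that of `H`, then `T` would be bounded on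
a dense subspace, hence bounded. If `S = H`, the closed graph theorem would bound `T`; if `S' = H`,
uniform boundedness would.

Density is immediate for the number operator, since `S` contains its eigenvectors `ε_k`. For
self-adjoint `T` no spectral theorem is used: `R = (1 + T^2)⁻¹` is a contraction with dense range,
so by a Mittag-Leffler argument the points with an infinite backward `R`-orbit are dense, and each
of them lies in `dom(T^∞)`. The Laplacian enters only through its unboundedness, which extensions
inherit.

The pairing formulas are Riesz representations on the closed range of `T^p`, or of `u ↦ (u, T u, …,
T^p u)`. A lower bound on `T` lets the last of these seminorms dominate the others. Nuclearity in
the diagonal case is the convergence of `∑ (k + 1)⁻²`. -/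

lemma powOn_mem_domain (p : ℕ) (u : TestSpace T) : powOn T p u ∈ T.domain := by
  have hu : (testIncl T u) ∈ (opPow T (p + 1)).domain := (Submodule.mem_iInf _).1 u.2 (p + 1)
  obtain ⟨_, h⟩ := (mem_opPow_succ T p _).1 hu
  exact h

lemma powOn_succ (p : ℕ) (u : TestSpace T) :
    powOn T (p + 1) u = T ⟨powOn T p u, powOn_mem_domain p u⟩ := rfl

lemma powOn_zero (u : TestSpace T) : powOn T 0 u = testIncl T u := rfl

lemma testIncl_injective : Function.Injective (testIncl T) := Subtype.val_injective

lemma powOn_mem_graph (p : ℕ) (u : TestSpace T) :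
    (powOn T p u, powOn T (p + 1) u) ∈ T.graph :=
  T.mem_graph ⟨powOn T p u, powOn_mem_domain p u⟩

/-- A sequence of iterates of `T` comes from an element of the test space. -/
lemma exists_testSpace_of_iterates (x : ℕ → H) (hx : ∀ p, (x p, x (p + 1)) ∈ T.graph) :
    ∃ u : TestSpace T, ∀ p, powOn T p u = x p := by
  have key : ∀ p, ∃ h : x 0 ∈ (opPow T p).domain, opPow T p ⟨x 0, h⟩ = x p := by
    intro p
    induction p with
    | zero => exact ⟨trivial, rfl⟩
    | succ p ih =>
      obtain ⟨h, hp⟩ := ih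
      obtain ⟨y, hy, hy'⟩ := (T.mem_graph_iff).1 (hx p)
      dsimp only at hy hy'
      have hmem : opPow T p ⟨x 0, h⟩ ∈ T.domain := by
        rw [hp]
        exact T.mem_domain_of_mem_graph (hx p)
      refine ⟨(mem_opPow_succ T p _).2 ⟨h, hmem⟩, ?_⟩
      rw [opPow_succ_apply T p _ _ h hmem, ← hy']
      congr 1
      exact Subtype.ext (hp.trans hy.symm)
  exact ⟨⟨x 0, (Submodule.mem_iInf _).2 fun p => (key p).1⟩, fun p => (key p).2⟩

/-- A set which `T` maps to its span spans a subspace of the test space. -/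
lemma exists_testSpace_of_mem_span {s : Set H}
    (hs : ∀ x ∈ s, ∃ y ∈ Submodule.span ℝ s, (x, y) ∈ T.graph) {x : H}
    (hx : x ∈ Submodule.span ℝ s) : ∃ u : TestSpace T, testIncl T u = x := by
  -- The points that have an image under `T` inside the span form a subspace, so it suffices to
  -- check generators.
  have h1 : Submodule.span ℝ s ≤ (T.graph ⊓ (Submodule.span ℝ s).comap (LinearMap.snd ℝ H H)).map
      (LinearMap.fst ℝ H H) := by
    refine Submodule.span_le.2 fun x hx => ?_
    obtain ⟨y, hy, hxy⟩ := hs x hx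
    exact ⟨(x, y), ⟨hxy, hy⟩, rfl⟩
  have h2 : ∀ x : Submodule.span ℝ s, ∃ y : Submodule.span ℝ s, ((x : H), (y : H)) ∈ T.graph := by
    intro x
    obtain ⟨⟨a, y⟩, ⟨hxy, hy⟩, rfl⟩ := h1 x.2
    exact ⟨⟨y, hy⟩, hxy⟩
  choose f hf using h2
  obtain ⟨u, hu⟩ := exists_testSpace_of_iterates (T := T) (fun p => (f^[p] ⟨x, hx⟩ : H)) (fun p => by
    rw [Function.iterate_succ_apply']
    exact hf _)
  exact ⟨u, hu 0⟩

lemma testSeminorm_apply (p : ℕ) (u : TestSpace T) : testSeminorm T p u = ‖powOn T p u‖ := rfl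

variable (T) in
/-- `powOn` as a continuous map. -/
def powOnL (p : ℕ) : TestSpace T →L[ℝ] H where
  toLinearMap := powOn T p
  cont := by
    refine WithSeminorms.continuous_normedSpace_rng H (withSeminorms_testSeminorm T) _
      ⟨{p}, 1, ?_⟩
    intro u
    simp only [Finset.sup_singleton, one_smul]
    exact le_rfl

/-! ### Fréchet structure of the test space -/

instance : T1Space (TestSpace T) := by
  refine (withSeminorms_testSeminorm T).T1_of_separating fun u hu => ⟨0, ?_⟩
  rw [testSeminorm_apply, powOn_zero, norm_ne_zero_iff]
  exact fun h => hu (testIncl_injective (h.trans (map_zero _).symm))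

instance : FirstCountableTopology (TestSpace T) :=
  (withSeminorms_testSeminorm T).firstCountableTopology

lemma TestSpace.metrizable : TopologicalSpace.MetrizableSpace (TestSpace T) := by
  let _ := IsTopologicalAddGroup.rightUniformSpace (TestSpace T)
  have : IsUniformAddGroup (TestSpace T) := isUniformAddGroup_of_addCommGroup
  have : (uniformity (TestSpace T)).IsCountablyGenerated :=
    IsUniformAddGroup.uniformity_countably_generated
  exact UniformSpace.metrizableSpace

/-- A Cauchy sequence has limits `x p` of `T^p u_n` for each `p`; the closed graph links `x p` to `x
(p + 1)`, so `x 0` is the limit in `S`. -/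
lemma TestSpace.complete [CompleteSpace H] (hT : T.IsClosed) :
    @CompleteSpace (TestSpace T) (IsTopologicalAddGroup.rightUniformSpace (TestSpace T)) := by
  let _ := IsTopologicalAddGroup.rightUniformSpace (TestSpace T)
  have : IsUniformAddGroup (TestSpace T) := isUniformAddGroup_of_addCommGroup
  have : (uniformity (TestSpace T)).IsCountablyGenerated :=
    IsUniformAddGroup.uniformity_countably_generated
  refine UniformSpace.complete_of_cauchySeq_tendsto fun u hu => ?_
  have h1 : ∀ p, ∃ x, Tendsto (fun n => powOn T p (u n)) atTop (𝓝 x) := fun p =>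
    cauchySeq_tendsto_of_complete ((powOnL T p).uniformContinuous.comp_cauchySeq hu)
  choose x hx using h1
  obtain ⟨w, hw⟩ := exists_testSpace_of_iterates (T := T) x fun p =>
    hT.mem_of_tendsto ((hx p).prodMk_nhds (hx (p + 1)))
      (Eventually.of_forall fun n => powOn_mem_graph p (u n))
  refine ⟨w, ((withSeminorms_testSeminorm T).tendsto_nhds_atTop u w).2 fun p ε hε => ?_⟩
  obtain ⟨N, hN⟩ := Metric.tendsto_atTop.1 (hx p) ε hε
  refine ⟨N, fun n hn => ?_⟩
  rw [testSeminorm_apply, map_sub, hw, ← dist_eq_norm]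
  exact hN n hn

/-- A closed operator that is bounded on a dense test space is bounded. -/
lemma not_bounded_powOn_one [CompleteSpace H] (hT : T.IsClosed) (hd : DenseRange (testIncl T))
    (hu : IsUnboundedOp T) : ¬ ∃ C, ∀ u, ‖powOn T 1 u‖ ≤ C * ‖testIncl T u‖ := by
  rintro ⟨C, hC⟩
  refine hu ⟨C, fun x => ?_⟩
  obtain ⟨u, hux⟩ : ∃ u : ℕ → TestSpace T, Tendsto (fun n => testIncl T (u n)) atTop (𝓝 (x : H)) := by
    obtain ⟨y, hy, hyx⟩ := mem_closure_iff_seq_limit.1 (hd (x : H))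
    choose u hu using hy
    exact ⟨u, by simpa only [hu] using hyx⟩
  -- The approximation of `x` is in the norm of `H` only; the supposed bound makes `T u_n` Cauchy,
  -- and closedness identifies its limit with `T x`.
  have hc : CauchySeq fun n => powOn T 1 (u n) := by
    rw [cauchySeq_iff_tendsto_dist_atTop_0]
    have h0 := (cauchySeq_iff_tendsto_dist_atTop_0.1 hux.cauchySeq).const_mul C
    rw [mul_zero] at h0
    refine squeeze_zero (fun _ => dist_nonneg) (fun n => ?_) h0
    rw [dist_eq_norm, dist_eq_norm, ← map_sub, ← map_sub]
    exact hC _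
  obtain ⟨y, hy⟩ := cauchySeq_tendsto_of_complete hc
  have hg : ((x : H), y) ∈ T.graph := hT.mem_of_tendsto (hux.prodMk_nhds hy)
    (Eventually.of_forall fun n => powOn_mem_graph 0 (u n))
  rw [T.mem_graph_snd_inj (T.mem_graph x) hg rfl]
  exact le_of_tendsto_of_tendsto' hy.norm (hux.norm.const_mul C) fun n => hC _

/-- The test space of an unbounded closed operator, if it is dense, gives a Gel'fand triple. -/
theorem isGelfandTriple_testIncl [CompleteSpace H] (hT : T.IsClosed)
    (hd : DenseRange (testIncl T)) (hu : IsUnboundedOp T) : IsGelfandTriple (testIncl T) := by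
  have hnb := not_bounded_powOn_one hT hd hu
  refine ⟨(withSeminorms_testSeminorm T).toLocallyConvexSpace, TestSpace.metrizable,
    TestSpace.complete hT, testIncl_injective, hd, ?_, ?_, ?_, ?_⟩
  · refine lt_of_le_of_ne (testIncl T).continuous.le_induced fun h => hnb ?_
    have hi : IsInducing ((testIncl T).toLinearMap) := ⟨h⟩
    -- For equal topologies the continuous seminorm `‖T u‖` would be dominated by the norm of `H`.
    obtain ⟨s, C, _, hC⟩ := Seminorm.bound_comp_of_isInducing
      ((withSeminorms_testSeminorm T).continuous_seminorm 1) (norm_withSeminorms ℝ H) hi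
    refine ⟨C, fun u => (hC u).trans ?_⟩
    rw [Seminorm.comp_apply, smul_apply]
    refine mul_le_mul_of_nonneg_left ?_ C.2
    exact Seminorm.finset_sup_apply_le (norm_nonneg _) fun i _ => le_rfl
  · intro hs
    have hdom : ∀ x, x ∈ T.domain := fun x => by
      obtain ⟨u, rfl⟩ := hs x
      exact powOn_mem_domain 0 u
    let f : H →ₗ[ℝ] H := T.toFun ∘ₗ LinearMap.codRestrict T.domain LinearMap.id hdom
    have hf : (f.graph : Set (H × H)) = T.graph := by
      ext ⟨x, y⟩
      rw [SetLike.mem_coe, SetLike.mem_coe, LinearMap.mem_graph_iff, T.mem_graph_iff]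
      constructor
      · rintro h
        exact ⟨⟨x, hdom x⟩, rfl, h.symm⟩
      · rintro ⟨z, hz, hz'⟩
        exact hz'.symm.trans (congr_arg T (Subtype.ext hz : z = ⟨x, hdom x⟩))
    have hcl : IsClosed (f.graph : Set (H × H)) := hf ▸ hT
    exact hu ⟨‖ContinuousLinearMap.ofIsClosedGraph hcl‖, fun x =>
      (ContinuousLinearMap.ofIsClosedGraph hcl).le_opNorm x⟩
  · intro h h' hh
    rw [← sub_eq_zero, ← inner_self_eq_zero (𝕜 := ℝ)]
    have h1 : (fun x : H => ⟪h - h', x⟫_ℝ) = fun _ => 0 := by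
      refine hd.equalizer (by fun_prop) (by fun_prop) (funext fun u => ?_)
      have := DFunLike.congr_fun hh u
      change ⟪h, testIncl T u⟫_ℝ = ⟪h', testIncl T u⟫_ℝ at this
      simp only [Function.comp_apply, inner_sub_left, this, sub_self]
    exact congr_fun h1 (h - h')
  · intro hs
    let ι := {u : TestSpace T // ‖testIncl T u‖ ≤ 1}
    -- If every functional came from `H`, then so would `⟪w, T ·⟫`. Its representative bounds the
    -- family `⟪T u, ·⟫`, `‖u‖ ≤ 1`, at the point `w`.
    obtain ⟨C, hC⟩ := banach_steinhaus (g := fun u : ι => innerSL ℝ (powOn T 1 u.1)) (fun w => by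
      obtain ⟨h, hh⟩ := hs ((innerSL ℝ w).comp (powOnL T 1))
      refine ⟨‖h‖, fun u => ?_⟩
      have h1 : ⟪h, testIncl T u.1⟫_ℝ = ⟪w, powOn T 1 u.1⟫_ℝ := DFunLike.congr_fun hh u.1
      rw [innerSL_apply_apply, real_inner_comm, ← h1]
      exact (norm_inner_le_norm _ _).trans (mul_le_of_le_one_right (norm_nonneg _) u.2))
    refine hnb ⟨C, fun u => ?_⟩
    rcases eq_or_ne (testIncl T u) 0 with h0 | h0
    · have : u = 0 := testIncl_injective (h0.trans (map_zero _).symm)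
      simp [this]
    · have h0' := norm_pos_iff.2 h0
      have h2 := hC ⟨‖testIncl T u‖⁻¹ • u, by
        rw [map_smul, norm_smul, norm_inv, norm_norm, inv_mul_cancel₀ h0'.ne']⟩
      rw [innerSL_apply_norm, map_smul, norm_smul, norm_inv, norm_norm, inv_mul_le_iff₀ h0'] at h2
      linarith

/-! ### Representation of functionals on the test space -/

/-- The Riesz representation of a functional that is dominated by the norm of a linear map. -/
lemma exists_inner_eq_of_le_norm {S K : Type*} [AddCommGroup S] [Module ℝ S]
    [NormedAddCommGroup K] [InnerProductSpace ℝ K] [CompleteSpace K] (L : S →ₗ[ℝ] K)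
    (f : S →ₗ[ℝ] ℝ) (C : ℝ) (hf : ∀ u, |f u| ≤ C * ‖L u‖) :
    ∃ w ∈ closure (Set.range L), ∀ u, f u = ⟪L u, w⟫_ℝ := by
  obtain ⟨σ, hσ⟩ := L.rangeRestrict.exists_rightInverse_of_surjective L.range_rangeRestrict
  have hσ' : ∀ x, L (σ x) = x := fun x => congr_arg Subtype.val (LinearMap.congr_fun hσ x)
  let g : StrongDual ℝ (LinearMap.range L) := (f ∘ₗ σ).mkContinuous C fun x => by
    have := hf (σ x)
    rwa [hσ'] at this
  -- The bound makes `f` vanish on the kernel of `L`, so the choice of the section `σ` does not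
  -- matter.
  have hg : ∀ u, g (L.rangeRestrict u) = f u := fun u => by
    have := hf (σ (L.rangeRestrict u) - u)
    rw [map_sub L, hσ', show ((L.rangeRestrict u : LinearMap.range L) : K) = L u from rfl, sub_self,
      norm_zero, mul_zero, map_sub] at this
    exact sub_eq_zero.1 (abs_nonpos_iff.1 this)
  obtain ⟨G, hG, -⟩ := exists_extension_norm_eq _ g
  have hc : (LinearMap.range L).topologicalClosure.HasOrthogonalProjection := inferInstance
  let w₀ := (InnerProductSpace.toDual ℝ K).symm G
  -- The Hahn-Banach extension is arbitrary off the range; projecting its Riesz vector puts it in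
  -- the closure.
  refine ⟨(LinearMap.range L).topologicalClosure.starProjection w₀, ?_, fun u => ?_⟩
  · have := (LinearMap.range L).topologicalClosure.starProjection_apply_mem w₀
    rwa [← SetLike.mem_coe, Submodule.topologicalClosure_coe, LinearMap.coe_range] at this
  · have hm : L u ∈ (LinearMap.range L).topologicalClosure :=
      Submodule.le_topologicalClosure _ ⟨u, rfl⟩
    rw [← Submodule.inner_starProjection_left_eq_right, Submodule.starProjection_eq_self_iff.2 hm,
      real_inner_comm, InnerProductSpace.toDual_symm_apply, ← hg u, ← hG]
    rfl

/-- The difference `w - w'` is orthogonal to the range and lies in its closure, hence is orthogonal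
to itself. -/
lemma eq_of_mem_closure_range {S K : Type*} [AddCommGroup S] [Module ℝ S]
    [NormedAddCommGroup K] [InnerProductSpace ℝ K] (L : S →ₗ[ℝ] K) {w w' : K}
    (hw : w ∈ closure (Set.range L)) (hw' : w' ∈ closure (Set.range L))
    (h : ∀ u, ⟪L u, w⟫_ℝ = ⟪L u, w'⟫_ℝ) : w = w' := by
  rw [← LinearMap.coe_range, ← Submodule.topologicalClosure_coe] at hw hw'
  have h1 := Submodule.sub_mem _ hw hw'
  rw [← SetLike.mem_coe, Submodule.topologicalClosure_coe, LinearMap.coe_range] at h1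
  rw [← sub_eq_zero, ← inner_self_eq_zero (𝕜 := ℝ)]
  refine closure_minimal (s := Set.range L) (t := {x | ⟪x, w - w'⟫_ℝ = 0}) ?_
    (isClosed_eq (by fun_prop) continuous_const) h1
  rintro _ ⟨u, rfl⟩
  rw [Set.mem_ofPred_eq, inner_sub_right, h, sub_self]

/-- A continuous functional on the test space is bounded by finitely many of the seminorms. -/
lemma exists_abs_le_sup_testSeminorm (v : TestSpace T →L[ℝ] ℝ) :
    ∃ (p : ℕ) (C : ℝ), 0 < C ∧ ∀ (u : TestSpace T) (M : ℝ), 0 ≤ M →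
      (∀ k < p + 1, ‖powOn T k u‖ ≤ M) → |v u| ≤ C * M := by
  obtain ⟨s, C, hC0, hC⟩ := Seminorm.bound_of_continuous (withSeminorms_testSeminorm T)
    ((normSeminorm ℝ ℝ).comp v.toLinearMap) (by
      change Continuous fun u => ‖v u‖
      fun_prop)
  -- Here `p` is the largest index among the finitely many seminorms of the bound.
  refine ⟨s.sup id, C, NNReal.coe_pos.2 (pos_iff_ne_zero.2 hC0), fun u M hM h => (hC u).trans ?_⟩
  rw [smul_apply]
  refine mul_le_mul_of_nonneg_left ?_ C.2
  refine Seminorm.finset_sup_apply_le hM fun k hk => h k ?_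
  exact Nat.lt_succ_of_le (Finset.le_sup (f := id) hk)

/-- Riesz is applied with `L = T^p` under an order bound, and in general with `L u = (u, T u, …, T^p
u)` in a Hilbert sum, whose norm dominates each of its components. -/
theorem hasEnergyPairing [CompleteSpace H] : HasEnergyPairing T := by
  refine ⟨LinearMap.mk₂ ℝ (fun u v => v u) (fun _ _ v => map_add v _ _)
    (fun _ _ v => map_smul v _ _) (fun _ _ _ => rfl) (fun _ _ _ => rfl), fun _ _ => rfl,
    fun u h => real_inner_comm _ _, ?_, ?_⟩
  · rintro v p ⟨K, -, hK⟩
    obtain ⟨w, hw, hvw⟩ := exists_inner_eq_of_le_norm (powOn T p) v.toLinearMap K hK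
    refine ⟨w, ⟨⟨hw, hvw⟩, hvw⟩, fun w' hw' => ?_⟩
    exact eq_of_mem_closure_range (powOn T p) hw'.1.1 hw fun u => by
      rw [← hvw u, ← hw'.2 u]
      rfl
  · intro v
    obtain ⟨p, C, -, hC⟩ := exists_abs_le_sup_testSeminorm v
    let L : TestSpace T →ₗ[ℝ] PiLp 2 fun _ : Fin (p + 1) => H :=
      (WithLp.linearEquiv 2 ℝ (Fin (p + 1) → H)).symm.toLinearMap ∘ₗ
        LinearMap.pi fun k => powOn T k
    obtain ⟨w, -, hw⟩ := exists_inner_eq_of_le_norm L v.toLinearMap C fun u =>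
      hC u _ (norm_nonneg _) fun k hk => PiLp.norm_apply_le (L u) ⟨k, hk⟩
    refine ⟨p, fun k => if hk : k < p + 1 then w ⟨k, hk⟩ else 0, fun u => ?_⟩
    rw [Finset.sum_range]
    refine (hw u).trans ?_
    rw [PiLp.inner_apply]
    refine Finset.sum_congr rfl fun k _ => ?_
    simp only [dif_pos k.2]
    rfl

/-- If `T` is bounded below, every functional on the test space is bounded by a single seminorm. -/
theorem exists_isOrderBound {δ : ℝ} (hδ : 0 < δ) (h : ∀ u : T.domain, δ * ‖(u : H)‖ ≤ ‖T u‖)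
    (v : TestSpace T →L[ℝ] ℝ) : ∃ p, IsOrderBound T v p := by
  obtain ⟨p, C, hC0, hC⟩ := exists_abs_le_sup_testSeminorm v
  have hδ' : ∀ j k (u : TestSpace T), ‖powOn T k u‖ ≤ δ⁻¹ ^ j * ‖powOn T (k + j) u‖ := by
    intro j k u
    induction j with
    | zero => simp
    | succ j ih =>
      refine ih.trans ?_
      rw [pow_succ, mul_assoc]
      refine mul_le_mul_of_nonneg_left ?_ (by positivity)
      rw [le_inv_mul_iff₀ hδ]
      exact h ⟨powOn T (k + j) u, powOn_mem_domain _ u⟩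
  -- The sum serves as a bound for every `δ⁻¹ ^ (p - k)` at once, whether or not `δ ≤ 1`.
  have h1 : 0 < ∑ j ∈ Finset.range (p + 1), δ⁻¹ ^ j :=
    Finset.sum_pos (fun _ _ => by positivity) (by simp)
  refine ⟨p, C * ∑ j ∈ Finset.range (p + 1), δ⁻¹ ^ j, mul_pos hC0 h1, fun u => ?_⟩
  rw [mul_assoc]
  refine hC u _ (by positivity) fun k hk => ?_
  have h2 := hδ' (p - k) k u
  rw [Nat.add_sub_cancel' (Nat.lt_succ_iff.1 hk)] at h2
  refine h2.trans (mul_le_mul_of_nonneg_right ?_ (norm_nonneg _))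
  exact Finset.single_le_sum (f := fun j => δ⁻¹ ^ j) (fun _ _ => by positivity)
    (Finset.mem_range.2 (by omega))

end TestSpaceTheory

/-! ## Density of the test space of a self-adjoint operator -/

section SelfAdjoint

open Filter Topology

variable {H : Type*} [NormedAddCommGroup H] [InnerProductSpace ℝ H] [CompleteSpace H]
  {T : H →ₗ.[ℝ] H}

/-- The resolvent `(1 + T ^ 2)⁻¹` of a self-adjoint operator, from the projection to its graph. -/
lemma exists_resolvent_sq (hT : IsSelfAdjoint T) :
    ∃ R : H →L[ℝ] H, (∀ x, ‖R x‖ ≤ ‖x‖) ∧ DenseRange R ∧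
      ∀ x, ∃ y, (R x, y) ∈ T.graph ∧ (y, x - R x) ∈ T.graph := by
  have hdense := hT.dense_domain
  let E := WithLp.prodContinuousLinearEquiv 2 ℝ H H
  let K : Submodule ℝ (WithLp 2 (H × H)) := T.graph.comap E.toLinearMap
  have hK : IsClosed (K : Set (WithLp 2 (H × H))) := hT.isClosed.preimage E.continuous
  have : CompleteSpace K := hK.completeSpace_coe
  let R : H →L[ℝ] H := (ContinuousLinearMap.fst ℝ H H).comp (E.toContinuousLinearMap.comp
    (K.starProjection.comp (E.symm.toContinuousLinearMap.comp (ContinuousLinearMap.inl ℝ H H))))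
  have key : ∀ x, ∃ y, (R x, y) ∈ T.graph ∧ (y, x - R x) ∈ T.graph := by
    intro x
    -- With `a = (R x, y)`, the residual `(x - R x, -y)` is orthogonal to the graph. This says that
    -- `y ∈ dom(T*)` and `T* y = x - R x`, and `T* = T`.
    let a := K.starProjection (E.symm (x, 0))
    have ha : a ∈ K := K.starProjection_apply_mem _
    have hg : (R x, (E a).2) ∈ T.graph := ha
    refine ⟨(E a).2, hg, ?_⟩
    have horth : ∀ z : T.domain, ⟪x - R x, (z : H)⟫_ℝ = ⟪(E a).2, T z⟫_ℝ := by
      intro z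
      have h1 : ⟪E.symm (x, 0) - a, E.symm ((z : H), T z)⟫_ℝ = 0 :=
        K.starProjection_inner_eq_zero _ _ (T.mem_graph z)
      rw [WithLp.prod_inner_apply] at h1
      change ⟪x - R x, (z : H)⟫_ℝ + ⟪0 - (E a).2, T z⟫_ℝ = 0 at h1
      rw [zero_sub, inner_neg_left] at h1
      linarith
    have hmem : (E a).2 ∈ T.adjoint.domain := T.mem_adjoint_domain_of_exists _ ⟨_, horth⟩
    have h2 := T.adjoint.mem_graph ⟨_, hmem⟩
    rw [LinearPMap.adjoint_apply_eq hdense ⟨_, hmem⟩ horth] at h2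
    have h3 : T.adjoint.graph = T.graph := by rw [LinearPMap.isSelfAdjoint_def.1 hT]
    exact h3 ▸ h2
  have hsymm : ∀ a b c d : H, (a, b) ∈ T.graph → (c, d) ∈ T.graph → ⟪b, c⟫_ℝ = ⟪a, d⟫_ℝ := by
    intro a b c d hab hcd
    obtain ⟨x, rfl, rfl⟩ := T.mem_graph_iff.1 hab
    obtain ⟨y, rfl, rfl⟩ := T.mem_graph_iff.1 hcd
    have h1 := LinearPMap.adjoint_isFormalAdjoint hdense
    rw [LinearPMap.isSelfAdjoint_def.1 hT] at h1
    exact h1 x y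
  -- Symmetry gives `⟪x - R x, R x⟫ = ‖y‖ ^ 2 ≥ 0` with `y = T R x`.
  have hinner : ∀ x, ‖R x‖ ^ 2 ≤ ⟪x, R x⟫_ℝ := by
    intro x
    obtain ⟨y, h1, h2⟩ := key x
    have h3 := hsymm _ _ _ _ h2 h1
    rw [inner_sub_left, real_inner_self_eq_norm_sq, real_inner_self_eq_norm_sq] at h3
    nlinarith [sq_nonneg ‖y‖]
  refine ⟨R, fun x => ?_, ?_, key⟩
  · have h1 := (hinner x).trans (real_inner_le_norm _ _)
    rcases (norm_nonneg (R x)).eq_or_lt with h0 | h0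
    · rw [← h0]
      exact norm_nonneg _
    · rw [sq] at h1
      exact le_of_mul_le_mul_right h1 h0
  · have h1 : (LinearMap.range R.toLinearMap).topologicalClosure = ⊤ := by
      rw [Submodule.topologicalClosure_eq_top_iff, Submodule.eq_bot_iff]
      intro g hg
      have h2 : ⟪R g, g⟫_ℝ = 0 := (Submodule.mem_orthogonal _ _).1 hg _ ⟨g, rfl⟩
      have h3 := hinner g
      rw [real_inner_comm, h2] at h3
      have h4 : R g = 0 := norm_eq_zero.1 (pow_eq_zero_iff two_ne_zero |>.1
        (le_antisymm h3 (sq_nonneg _)))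
      obtain ⟨y, h5, h6⟩ := key g
      rw [h4] at h5 h6
      rw [T.graph_fst_eq_zero_snd h5 rfl, sub_zero] at h6
      exact T.graph_fst_eq_zero_snd h6 rfl
    have := (Submodule.dense_iff_topologicalClosure_eq_top).2 h1
    rwa [LinearMap.coe_range] at this

/-- The Mittag-Leffler argument: backward orbits of a contraction with dense range start at a dense
set of points. -/
lemma exists_backward_orbit {R : H →L[ℝ] H} (hR : ∀ x, ‖R x‖ ≤ ‖x‖) (hd : DenseRange R) (x : H)
    {ε : ℝ} (hε : 0 < ε) : ∃ h : ℕ → H, (∀ k, R (h (k + 1)) = h k) ∧ dist x (h 0) ≤ ε := by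
  -- The sequence `a` is an approximate backward orbit of `x`; its errors `ε / 2 / 2 ^ n` sum to
  -- `ε`.
  have step : ∀ (n : ℕ) (y : H), ∃ z, dist y (R z) < ε / 2 / 2 ^ n := fun n y =>
    hd.exists_dist_lt y (by positivity)
  choose f hf using step
  let a : ℕ → H := fun n => Nat.rec x (fun n y => f n y) n
  have ha : ∀ n, dist (a n) (R (a (n + 1))) ≤ ε / 2 / 2 ^ n := fun n => (hf n (a n)).le
  have hpow : ∀ n y z, dist ((R ^ n) y) ((R ^ n) z) ≤ dist y z := by
    intro n
    induction n with
    | zero => simp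
    | succ n ih =>
      intro y z
      rw [pow_succ]
      refine (ih (R y) (R z)).trans ?_
      rw [dist_eq_norm, dist_eq_norm, ← map_sub]
      exact hR _
  have hstep : ∀ k n, dist ((R ^ n) (a (n + k))) ((R ^ (n + 1)) (a (n + 1 + k))) ≤ ε / 2 / 2 ^ n := by
    intro k n
    rw [pow_succ]
    refine (hpow n _ (R _)).trans ?_
    rw [add_right_comm]
    refine (ha (n + k)).trans ?_
    gcongr
    · norm_num
    · omega
  -- The exact orbit is `h k = lim R^n (a (n + k))`; contractivity of `R^n` keeps the errors
  -- summable.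
  have hlim : ∀ k, ∃ l, Tendsto (fun n => (R ^ n) (a (n + k))) atTop (𝓝 l) := fun k =>
    cauchySeq_tendsto_of_complete (cauchySeq_of_le_geometric_two (hstep k))
  choose h hh using hlim
  refine ⟨h, fun k => ?_, ?_⟩
  · have h1 := (R.continuous.tendsto _).comp (hh (k + 1))
    refine tendsto_nhds_unique h1 (((hh k).comp (tendsto_add_atTop_nat 1)).congr fun n => ?_)
    simp only [Function.comp_apply]
    rw [pow_succ', add_assoc, add_comm 1 k]
    rfl
  · have := dist_le_of_le_geometric_two_of_tendsto₀ (hstep 0) (hh 0)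
    rwa [pow_zero] at this

/-- Along a backward orbit `R h_{k+1} = h_k`, the vectors `y_k = T h_k` satisfy `T y_k = h_{k+1} -
h_k`. So `T` preserves the span of all `h_k` and `y_k`, which therefore lies in `dom(T^∞)`. -/
theorem denseRange_testIncl_of_isSelfAdjoint (hT : IsSelfAdjoint T) :
    DenseRange (testIncl T) := by
  obtain ⟨R, hR, hd, hRT⟩ := exists_resolvent_sq hT
  intro x
  refine Metric.mem_closure_iff.2 fun ε hε => ?_
  obtain ⟨h, hh, hx⟩ := exists_backward_orbit hR hd x (half_pos hε)
  choose y hy hy' using fun k => hRT (h (k + 1))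
  simp only [hh] at hy hy'
  have hsub : ∀ k, h k ∈ Submodule.span ℝ (Set.range h ∪ Set.range y) := fun k =>
    Submodule.subset_span (Or.inl ⟨k, rfl⟩)
  obtain ⟨u, hu⟩ := exists_testSpace_of_mem_span (T := T) (s := Set.range h ∪ Set.range y) (by
    rintro _ (⟨k, rfl⟩ | ⟨k, rfl⟩)
    · exact ⟨y k, Submodule.subset_span (Or.inr ⟨k, rfl⟩), hy k⟩
    · exact ⟨_, Submodule.sub_mem _ (hsub (k + 1)) (hsub k), hy' k⟩) (hsub 0)
  exact ⟨_, ⟨u, rfl⟩, by rw [hu]; linarith⟩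

end SelfAdjoint

/-! ## Diagonal operators -/

section Diagonal

open Filter Topology

variable {H : Type*} [NormedAddCommGroup H] [InnerProductSpace ℝ H] {T : H →ₗ.[ℝ] H}

/-- A weakly diagonal operator with eigenvalues `k + 1` on a Hilbert basis. -/
structure IsDiagonalOn (T : H →ₗ.[ℝ] H) (b : HilbertBasis ℕ ℝ H) : Prop where
  mem_graph : ∀ k, (b k, ((k : ℝ) + 1) • b k) ∈ T.graph
  inner_eq : ∀ (k : ℕ) (u : T.domain), ⟪b k, T u⟫_ℝ = ((k : ℝ) + 1) * ⟪b k, (u : H)⟫_ℝ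

variable {b : HilbertBasis ℕ ℝ H}

lemma IsDiagonalOn.denseRange (h : IsDiagonalOn T b) : DenseRange (testIncl T) := by
  have h1 := (Submodule.dense_iff_topologicalClosure_eq_top).2 b.dense_span
  refine h1.mono fun x hx => ?_
  refine exists_testSpace_of_mem_span (s := Set.range b) ?_ hx
  rintro _ ⟨k, rfl⟩
  exact ⟨_, Submodule.smul_mem _ _ (Submodule.subset_span ⟨k, rfl⟩), h.mem_graph k⟩

lemma IsDiagonalOn.isUnbounded (h : IsDiagonalOn T b) : IsUnboundedOp T := by
  rintro ⟨C, hC⟩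
  obtain ⟨k, hk⟩ := exists_nat_gt C
  obtain ⟨u, hu, hTu⟩ := T.mem_graph_iff.1 (h.mem_graph k)
  have h1 := hC u
  have h2 : ‖b k‖ = 1 := b.orthonormal.1 k
  dsimp only at hu hTu
  rw [hu, hTu, norm_smul, h2, Real.norm_of_nonneg (by positivity)] at h1
  linarith

/-- Parseval, with all eigenvalues at least `1`. -/
lemma IsDiagonalOn.norm_le (h : IsDiagonalOn T b) (u : T.domain) : ‖(u : H)‖ ≤ ‖T u‖ := by
  have h1 := b.hasSum_inner_mul_inner (u : H) (u : H)
  have h2 := b.hasSum_inner_mul_inner (T u) (T u)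
  rw [real_inner_self_eq_norm_sq] at h1 h2
  refine (pow_le_pow_iff_left₀ (norm_nonneg _) (norm_nonneg _) two_ne_zero).1
    (hasSum_le (fun k => ?_) h1 h2)
  rw [real_inner_comm, real_inner_comm _ (T u), h.inner_eq]
  have hk : (0 : ℝ) ≤ k := k.cast_nonneg
  nlinarith [sq_nonneg ⟪b k, (u : H)⟫_ℝ, mul_nonneg hk (sq_nonneg ⟪b k, (u : H)⟫_ℝ),
    mul_nonneg hk (mul_nonneg hk (sq_nonneg ⟪b k, (u : H)⟫_ℝ))]

lemma IsDiagonalOn.inner_powOn (h : IsDiagonalOn T b) (p k : ℕ) (u : TestSpace T) :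
    ⟪b k, powOn T p u⟫_ℝ = ((k : ℝ) + 1) ^ p * ⟪b k, testIncl T u⟫_ℝ := by
  induction p with
  | zero => rw [powOn_zero, pow_zero, one_mul]
  | succ p ih => rw [powOn_succ, h.inner_eq, ih, pow_succ']; ring

/-- Expand `u = ∑ (k + 1)⁻² ⟪b k, T^2 u⟫ b k`: two powers of `T` pay for summable coefficients, and
`‖T^2 u‖ < 1` is the neighbourhood that shows equicontinuity. -/
theorem IsDiagonalOn.isNuclearMap (h : IsDiagonalOn T b) : IsNuclearMap (testIncl T) := by
  refine ⟨fun k => 1 / ((k : ℝ) + 1) ^ 2, fun k => (innerSL ℝ (b k)).comp (powOnL T 2), b, ?_,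
    ⟨{u | ‖powOnL T 2 u‖ < 1}, ?_, fun k u hu => ?_⟩, ⟨1, fun k => (b.orthonormal.1 k).le⟩,
    fun u => ?_⟩
  · have h1 := (summable_nat_add_iff 1).2 (Real.summable_one_div_nat_pow.2 one_lt_two)
    refine h1.congr fun k => ?_
    rw [abs_of_nonneg (by positivity)]
    push_cast
    rfl
  · refine (isOpen_lt (by fun_prop) continuous_const).mem_nhds ?_
    simp
  · refine (norm_inner_le_norm (𝕜 := ℝ) (b k) (powOn T 2 u)).trans ?_
    rw [b.orthonormal.1 k, one_mul]
    exact hu.le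
  · refine (b.hasSum_repr (testIncl T u)).congr_fun fun k => ?_
    rw [HilbertBasis.repr_apply_apply]
    congr 1
    change 1 / ((k : ℝ) + 1) ^ 2 * ⟪b k, powOn T 2 u⟫_ℝ = _
    rw [h.inner_powOn]
    field_simp

/-- An operator whose graph is diagonal in a total family is closable, and its closure is diagonal. -/
lemma isClosable_and_inner_closure {N : H →ₗ.[ℝ] H} {e : ℕ → H} (c : ℕ → ℝ)
    (he : (Submodule.span ℝ (Set.range e)).topologicalClosure = ⊤)
    (hN : ∀ x y, (x, y) ∈ N.graph → ∀ k, ⟪e k, y⟫_ℝ = c k * ⟪e k, x⟫_ℝ) :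
    N.IsClosable ∧ ∀ x y, (x, y) ∈ N.closure.graph → ∀ k, ⟪e k, y⟫_ℝ = c k * ⟪e k, x⟫_ℝ := by
  have h1 : ∀ x y, (x, y) ∈ N.graph.topologicalClosure →
      ∀ k, ⟪e k, y⟫_ℝ = c k * ⟪e k, x⟫_ℝ := by
    intro x y hxy k
    refine closure_minimal (s := (N.graph : Set (H × H)))
      (t := {z | ⟪e k, z.2⟫_ℝ = c k * ⟪e k, z.1⟫_ℝ}) (fun z hz => hN z.1 z.2 hz k)
      (isClosed_eq (by fun_prop) (by fun_prop)) hxy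
  have h2 : N.IsClosable := by
    refine ⟨N.graph.topologicalClosure.toLinearPMap, ?_⟩
    refine (Submodule.toLinearPMap_graph_eq _ fun z hz hz1 => ?_).symm
    -- The diagonal relation passes to limits, so a limit pair `(0, z.2)` has `z.2` orthogonal to a
    -- total family.
    have h3 : z.2 ∈ (Submodule.span ℝ (Set.range e))ᗮ := by
      rw [Submodule.mem_orthogonal]
      intro w hw
      induction hw using Submodule.span_induction with
      | mem w hw =>
        obtain ⟨k, rfl⟩ := hw
        rw [h1 z.1 z.2 hz k, hz1, inner_zero_right, mul_zero]
      | zero => exact inner_zero_left _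
      | add a b _ _ ha hb => rw [inner_add_left, ha, hb, add_zero]
      | smul r a _ ha => rw [inner_smul_left, ha, mul_zero]
    rw [← Submodule.orthogonal_closure, he, Submodule.top_orthogonal_eq_bot] at h3
    exact h3
  refine ⟨h2, ?_⟩
  rwa [← h2.graph_closure_eq_closure_graph]

end Diagonal

/-! ## The number operator -/

namespace ResistanceNetwork

variable {V : Type*} (G : ResistanceNetwork V) (o : V)

/-- The Kronecker delta at a vertex, a function of finite energy. -/
lemma single_mem_domE [DecidableEq V] (x : V) : Pi.single x (1 : ℝ) ∈ G.domE := by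
  have h1 : Summable fun p : V × V => G.c p.1 p.2 * (if p.1 = x then 1 else 0) := by
    have h2 : Function.Injective fun y : V => (x, y) := fun _ _ h => (Prod.mk.inj h).2
    refine (h2.summable_iff fun p hp => ?_).1 ((G.summable x).congr fun y => by simp)
    rw [if_neg fun h => hp ⟨p.2, by rw [← h]⟩, mul_zero]
  have h3 := h1.add ((Equiv.prodComm V V).summable_iff.2 h1)
  refine Summable.of_nonneg_of_le (fun p => mul_nonneg (G.nonneg _ _) (sq_nonneg _)) (fun p => ?_) h3
  simp only [Function.comp_apply, Equiv.prodComm_apply, Prod.fst_swap, Prod.snd_swap,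
    G.symm p.2 p.1, Pi.single_apply, ← mul_add]
  refine mul_le_mul_of_nonneg_left ?_ (G.nonneg _ _)
  by_cases h1 : p.1 = x <;> by_cases h2 : p.2 = x <;> simp [h1, h2]

/-- Pairing a linear relation with the Kronecker delta at `i ≠ o` isolates the coefficient of `v_i`.
-/
lemma linearIndependent_kernel : LinearIndependent ℝ fun x : {x : V // x ≠ o} => G.kernel o x := by
  classical
  rw [linearIndependent_iff']
  intro s g hg i hi
  have h1 := congr_arg (fun a => ⟪a, G.cls ⟨_, G.single_mem_domE i.1⟩⟫_ℝ) hg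
  simp only [sum_inner, inner_smul_left, inner_kernel, evalDiff_cls, inner_zero_left] at h1
  rw [Finset.sum_eq_single i] at h1
  · simpa [Pi.single_apply, i.2.symm] using h1
  · intro j _ hj
    have : (j : V) ≠ i := fun h => hj (Subtype.ext h)
    simp [i.2.symm, this]
  · exact fun h => absurd hi h

lemma eq_zero_of_inner_kernel (a : G.EnergySpace)
    (h : ∀ x : {x : V // x ≠ o}, ⟪G.kernel o x, a⟫_ℝ = 0) : a = 0 := by
  obtain ⟨u, rfl⟩ := G.cls_surjective a
  refine G.cls_eq_zero.2 ⟨u.1 o, fun x => ?_⟩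
  by_cases hx : x = o
  · rw [hx]
  · have h1 := h ⟨x, hx⟩
    rw [inner_kernel, evalDiff_cls] at h1
    exact sub_eq_zero.1 h1

/-! ### Gram-Schmidt basis and the diagonal form of the number operator -/

variable (e : ℕ ≃ {x : V // x ≠ o})

lemma linearIndependent_kernel_enum : LinearIndependent ℝ fun n => G.kernel o (e n) :=
  (G.linearIndependent_kernel o).comp e e.injective

lemma onb_orthonormal : Orthonormal ℝ (G.onb o e) :=
  InnerProductSpace.gramSchmidtNormed_orthonormal (G.linearIndependent_kernel_enum o e)

lemma span_onb : Submodule.span ℝ (Set.range (G.onb o e)) =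
    Submodule.span ℝ (Set.range fun n => G.kernel o (e n)) :=
  (InnerProductSpace.span_gramSchmidtNormed_range _).trans (InnerProductSpace.span_gramSchmidt ℝ _)

lemma span_onb_dense : (Submodule.span ℝ (Set.range (G.onb o e))).topologicalClosure = ⊤ := by
  rw [span_onb, Submodule.topologicalClosure_eq_top_iff, Submodule.eq_bot_iff]
  intro a ha
  refine G.eq_zero_of_inner_kernel o a fun x => ?_
  refine (Submodule.mem_orthogonal _ _).1 ha _ (Submodule.subset_span ⟨e.symm x, ?_⟩)
  simp

/-- The orthonormal basis obtained from the energy kernel. -/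
noncomputable def energyBasis : HilbertBasis ℕ ℝ G.EnergySpace :=
  HilbertBasis.mk (G.onb_orthonormal o e) (G.span_onb_dense o e).ge

lemma coe_energyBasis : ⇑(G.energyBasis o e) = G.onb o e := HilbertBasis.coe_mk _ _

/-- `v_{x_n}` is orthogonal to `ε_k` for `n < k`. -/
lemma inner_onb_kernel_of_lt {n k : ℕ} (h : n < k) : ⟪G.onb o e k, G.kernel o (e n)⟫_ℝ = 0 := by
  rw [onb, InnerProductSpace.gramSchmidtNormed, inner_smul_left,
    InnerProductSpace.gramSchmidt_inv_triangular _ _ h, mul_zero]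

/-- The sum stops at `n`, but by triangularity `v_{x_n}` has no component along `ε_k` for `k > n`,
so both sides vanish there. -/
lemma inner_onb_numberOperator_sum (n k : ℕ) :
    ⟪G.onb o e k, ∑ j ∈ Finset.range (n + 1),
      (((j : ℝ) + 1) * G.evalDiff (e n) o (G.onb o e j)) • G.onb o e j⟫_ℝ =
      ((k : ℝ) + 1) * ⟪G.onb o e k, G.kernel o (e n)⟫_ℝ := by
  simp only [inner_sum, inner_smul_right, ← inner_kernel]
  simp only [orthonormal_iff_ite.1 (G.onb_orthonormal o e), mul_ite, mul_one, mul_zero,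
    Finset.sum_ite_eq, Finset.mem_range]
  split_ifs with h
  · rw [real_inner_comm]
  · rw [G.inner_onb_kernel_of_lt o e (by omega), mul_zero]

/-- The span that defines the number operator. -/
def numberGraph : Submodule ℝ (G.EnergySpace × G.EnergySpace) :=
  Submodule.span ℝ (Set.range fun n : ℕ =>
    (G.kernel o (e n), ∑ k ∈ Finset.range (n + 1),
      (((k : ℝ) + 1) * G.evalDiff (e n) o (G.onb o e k)) • G.onb o e k))

lemma inner_of_mem_numberGraph {x y : G.EnergySpace} (h : (x, y) ∈ G.numberGraph o e) (k : ℕ) :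
    ⟪G.onb o e k, y⟫_ℝ = ((k : ℝ) + 1) * ⟪G.onb o e k, x⟫_ℝ := by
  have h1 : G.numberGraph o e ≤ LinearMap.ker
      (((innerSL ℝ (G.onb o e k)).toLinearMap ∘ₗ LinearMap.snd ℝ _ _) -
        ((k : ℝ) + 1) • ((innerSL ℝ (G.onb o e k)).toLinearMap ∘ₗ LinearMap.fst ℝ _ _)) := by
    refine Submodule.span_le.2 ?_
    rintro _ ⟨n, rfl⟩
    exact sub_eq_zero.2 (G.inner_onb_numberOperator_sum o e n k)
  exact sub_eq_zero.1 (h1 h)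

lemma eq_of_inner_onb {y z : G.EnergySpace} (h : ∀ k, ⟪G.onb o e k, y⟫_ℝ = ⟪G.onb o e k, z⟫_ℝ) :
    y = z := by
  refine (G.energyBasis o e).repr.injective (Subtype.ext (funext fun k => ?_))
  rw [HilbertBasis.repr_apply_apply, HilbertBasis.repr_apply_apply, coe_energyBasis]
  exact h k

/-- `toLinearPMap` has the given span as its graph only if the span is single-valued; the diagonal
relation ensures this. -/
lemma graph_numberOperator : (G.numberOperator o e).graph = G.numberGraph o e :=
  Submodule.toLinearPMap_graph_eq _ fun z hz hz1 => G.eq_of_inner_onb o e fun k => by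
    rw [G.inner_of_mem_numberGraph o e (x := z.1) (y := z.2) hz k, hz1, inner_zero_right, mul_zero]

/-- As `ε_k` lies in the span of the `v_x`, it occurs as a first component; the diagonal relation
then fixes all coefficients of the second. -/
lemma onb_mem_numberGraph (k : ℕ) :
    (G.onb o e k, ((k : ℝ) + 1) • G.onb o e k) ∈ G.numberGraph o e := by
  have h1 : G.onb o e k ∈ (G.numberGraph o e).map (LinearMap.fst ℝ _ _) := by
    rw [numberGraph, Submodule.map_span, ← Set.range_comp]
    change G.onb o e k ∈ Submodule.span ℝ (Set.range fun n => G.kernel o (e n))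
    rw [← span_onb]
    exact Submodule.subset_span ⟨k, rfl⟩
  obtain ⟨⟨x, y⟩, hxy, hx⟩ := h1
  obtain rfl : x = G.onb o e k := hx
  have h2 : ((k : ℝ) + 1) • G.onb o e k = y := G.eq_of_inner_onb o e fun j => by
    rw [G.inner_of_mem_numberGraph o e hxy j, inner_smul_right,
      orthonormal_iff_ite.1 (G.onb_orthonormal o e)]
    split_ifs with h
    · rw [h]
    · rw [mul_zero, mul_zero]
  rwa [h2]

lemma isClosed_and_isDiagonalOn_numberOperator :
    (G.numberOperator o e).closure.IsClosed ∧
      IsDiagonalOn (G.numberOperator o e).closure (G.energyBasis o e) := by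
  obtain ⟨h1, h2⟩ := isClosable_and_inner_closure (N := G.numberOperator o e)
    (fun k => (k : ℝ) + 1) (G.span_onb_dense o e) (fun x y hxy => by
      rw [graph_numberOperator] at hxy
      exact G.inner_of_mem_numberGraph o e hxy)
  refine ⟨h1.closure_isClosed, fun k => ?_, fun k u => ?_⟩
  · rw [coe_energyBasis]
    refine LinearPMap.le_graph_of_le (LinearPMap.le_closure _) ?_
    rw [graph_numberOperator]
    exact G.onb_mem_numberGraph o e k
  · rw [coe_energyBasis]
    exact h2 _ _ (LinearPMap.mem_graph _ u) k

end ResistanceNetwork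

lemma IsUnboundedOp.of_le {H : Type*} [NormedAddCommGroup H] [InnerProductSpace ℝ H]
    {S T : H →ₗ.[ℝ] H} (hS : IsUnboundedOp S) (h : S ≤ T) : IsUnboundedOp T := by
  rintro ⟨C, hC⟩
  refine hS ⟨C, fun u => ?_⟩
  rw [h.2 (x := u) (y := ⟨u, h.1 u.2⟩) rfl]
  exact hC ⟨u, h.1 u.2⟩

theorem mainTheorem5 {V : Type*} (G : ResistanceNetwork V) (o : V) :
    -- the closed number operator of an infinite network, for any enumeration of the vertices
    (∀ (e : ℕ ≃ {x : V // x ≠ o}) (T : G.EnergySpace →ₗ.[ℝ] G.EnergySpace),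
      T = (G.numberOperator o e).closure →
        IsGelfandTriple (testIncl T) ∧ IsNuclearMap (testIncl T) ∧ HasEnergyPairing T ∧
          ∀ v : TestSpace T →L[ℝ] ℝ, ∃ p, IsOrderBound T v p) ∧
    -- any self-adjoint extension of the Laplacian, if the latter is unbounded
    (∀ T : G.EnergySpace →ₗ.[ℝ] G.EnergySpace,
      G.laplacianM o ≤ T → IsSelfAdjoint T → IsUnboundedOp (G.laplacianM o) →
        IsGelfandTriple (testIncl T) ∧ HasEnergyPairing T ∧
          ((∃ δ > 0, ∀ u : T.domain, δ * ‖(u : G.EnergySpace)‖ ≤ ‖T u‖) →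
            ∀ v : TestSpace T →L[ℝ] ℝ, ∃ p, IsOrderBound T v p)) := by
  refine ⟨?_, ?_⟩
  · rintro e T rfl
    obtain ⟨hc, hd⟩ := G.isClosed_and_isDiagonalOn_numberOperator o e
    -- The lower bound is `δ = 1`, the smallest eigenvalue.
    exact ⟨isGelfandTriple_testIncl hc hd.denseRange hd.isUnbounded, hd.isNuclearMap,
      hasEnergyPairing, exists_isOrderBound one_pos fun u => by rw [one_mul]; exact hd.norm_le u⟩
  · intro T hle hT hu
    exact ⟨isGelfandTriple_testIncl hT.isClosed (denseRange_testIncl_of_isSelfAdjoint hT)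
      (hu.of_le hle), hasEnergyPairing, fun ⟨_, hδ, h⟩ => exists_isOrderBound hδ h⟩
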